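/- Write $e(z)=e^{2\pi i z}$. Call a real number $C_{MPS}>0$ a McGehee–Pigno–Smith constant if for all integers $a_1<\dots<a_N$ and all complex numbers $u_1,\dots,u_N$ $$\int_0^1\Big|\sum_{j=1}^N u_j e(a_jt)\Big|\,dt\ \ge\ C_{MPS}\sum_{j=1}^N\frac{|u_j|}{j}.$$ A finite set $A\subseteq\mathbb Z$ is called $n$-strongly $1$-dimensional if $|A|\ge n$. Inductively, for $r\ge 2$, real numbers $\delta_1,\dots,\delta_{r-1}>0$ and positive integers $n_1,\dots,n_r$, a finite set $A\subseteq\mathbb Z$ is called $(\delta_1,\dots,\delta_{r-1};n_1,\dots,n_r)$-strongly $r$-dimensional if there are integers $d_1,d_2$ with $d_2>(2+\delta_1)d_1$, a finite set $I$ of at least $n_1$ integers, and for each $k\in I$ a set $A_k\subseteq\{-d_1,\dots,d_1\}$ that is $(\delta_2,\dots,\delta_{r-1};n_2,\dots,n_r)$-strongly $(r-1)$-dimensional, such that $$A=\bigcup_{k\in I}(A_k+kd_2).$$ **Theorem.** McGehee–Pigno–Smith constants exist. Moreover, let $C_{MPS}>0$ be any such constant, let $r\ge1$, let $\delta_1,\dots,\delta_{r-1}>0$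 be real numbers and let $n_1,\dots,n_r$ be positive integers with $$n_i\ \ge\ \pi^3\,2^{21}\,C_{MPS}^3\prod_{j=i}^r(\log n_j)^3\qquad(1\le i\le r).$$ If $A\subseteq\mathbb Z$ is a finite $(\delta_1,\dots,\delta_{r-1};n_1,\dots,n_r)$-strongly $r$-dimensional set, then $$\int_0^1\Big|\sum_{a\in A}e(at)\Big|\,dt\ \ge\ C_{MPS}^r\,(2^9\pi)^{-r}\prod_{j=1}^{r-1}\bigl(2+\log(1+2/\delta_j)\bigr)^{-1}\,\log(n_1)\cdots\log(n_r).$$ -/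

import Mathlib

namespace Littlewood

/-- The additive character `e(x) = exp(2πix)`. -/
noncomputable def e (x : ℝ) : ℂ := Complex.exp (2 * (Real.pi : ℂ) * Complex.I * (x : ℂ))

/-- `C` is an admissible constant in the McGehee-Pigno-Smith inequality: for all integers
`a_1 < ... < a_N` and all complex numbers `u_1, ..., u_N`,
`∫_0^1 |∑_j u_j e(a_j t)| dt ≥ C ∑_j |u_j| / j`.
The index `j : Fin N` starts at `0`, whence the denominator `j + 1`. -/
def IsMPSConstant (C : ℝ) : Prop :=
  ∀ (N : ℕ) (a : Fin N → ℤ) (u : Fin N → ℂ), StrictMono a →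
    C * ∑ j : Fin N, ‖u j‖ / (((j : ℕ) : ℝ) + 1) ≤
      ∫ t in (0 : ℝ)..1, ‖∑ j : Fin N, u j * e ((a j : ℝ) * t)‖

/-- `IsStronglyDim m δ n A`: with `r = m + 1`, the finite set `A` of integers is
`(δ_1, ..., δ_{r-1}; n_1, ..., n_r)`-strongly `r`-dimensional. Indices are shifted by one:
`δ i` stands for `δ_{i+1}` and `n i` for `n_{i+1}`; `Fin.tail` drops the first entry. -/
def IsStronglyDim : (m : ℕ) → (Fin m → ℝ) → (Fin (m + 1) → ℕ) → Finset ℤ → Prop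
  | 0, _, n, A => n 0 ≤ A.card
  | m + 1, δ, n, A =>
      ∃ (d₁ d₂ : ℤ) (I : Finset ℤ) (B : ℤ → Finset ℤ),
        (2 + δ 0) * (d₁ : ℝ) < (d₂ : ℝ) ∧
        n 0 ≤ I.card ∧
        (∀ k ∈ I, B k ⊆ Finset.Icc (-d₁) d₁ ∧
          IsStronglyDim m (Fin.tail δ) (Fin.tail n) (B k)) ∧
        A = I.biUnion (fun k => (B k).image (fun x => x + k * d₂))

end Littlewood

/-!
The proof has two independent halves.

*Existence of a McGehee–Pigno–Smith constant.* By duality it suffices to find a bounded `Φ` on the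
circle with `∫ e(a_j x) Φ(x) dx` close to `σ_j / j`, where `σ_j u_j = |u_j|`. Group the indices
`j` into blocks `4 ^ k ≤ j < 4 ^ (k + 1)` and let `g_k` be `4 ^ (-k) ∑ σ_j e(-a_j x)` over the
`k`-th block: it is bounded by `3` and has `L²` norm `O(2 ^ (-k))`. The sum of the `g_k` has the
right coefficients but need not be bounded. Each `|g_k|` is therefore dominated by the real part
of an analytic polynomial `h_k` (frequencies `≥ 0`) whose `L²` norm is still `O(2 ^ (-k))`
(`exists_analytic_majorant`), and one takes
`Φ = ∑_k g_k exp(-(h_{k+1} + h_{k+2} + ⋯) / 28)`. Adding one block at a time, `|Φ|` obeys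
`y ↦ y exp(-x / 28) + x` with `0 ≤ x ≤ 3`, which preserves `y ≤ 31` (`norm_testFun_le`). The
exponential factors have nonnegative spectrum, so `g_k` disturbs the coefficient at `a_j` only
when the block of `j` is at most `k`, and the resulting geometric series of `L²` estimates is at
most half of the main term (`norm_mean_mul_testFun_sub_le`).

*Multidimensional sets.* Let `A = ⋃ (A_k + k d₂)` and let `f_k` be the exponential sum of `A_k`,
of degree at most `d₁`. The two-variable polynomial `F(x, s) = ∑ f_k(x) e(k d₂ s)` agrees with the
exponential sum of `A` at the points `x = s + l / d₂`. For fixed `s` it has degree at most `d₁`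
in `x`, and `d₂ > 2 d₁`, so its `L¹` norm in `x` is bounded by its average over the nodes
`s + l / d₂` times the `L¹` norm of a trapezoidal kernel (`integral_norm_le_sum_nodes`), which is
at most `2 + log (1 + 2 d₁ / (d₂ - 2 d₁)) ≤ 2 + log (1 + 2 / δ)` (`integral_norm_trapezoid_le`).
Hence `‖F‖₁` is controlled by the `L¹` norm for `A` (`integral_twoVariable_le`). The
McGehee–Pigno–Smith inequality in the variable `s` bounds `‖F‖₁` from below by
`C ∑_j ‖f_{k_j}‖₁ / j` (`sum_fibre_integral_le`), and induction on the dimension finishes the proof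
(`IsStronglyDim.le_integral`), with a stronger constant than the one required.
-/

namespace Littlewood

open MeasureTheory AddCircle Polynomial

/-! ### Analytic polynomials on the circle -/

lemma integrable_haar {E : Type*} [NormedAddCommGroup E] {f : UnitAddCircle → E}
    (hf : Continuous f) : Integrable f (haarAddCircle (T := (1 : ℝ))) :=
  hf.integrable_of_hasCompactSupport (HasCompactSupport.of_compactSpace f)

lemma integral_haar_eq_intervalIntegral {E : Type*} [NormedAddCommGroup E] [NormedSpace ℝ E]
    (f : UnitAddCircle → E) :
    ∫ x, f x ∂(haarAddCircle (T := (1 : ℝ))) = ∫ t in (0 : ℝ)..1, f t := by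
  rw [integral_haarAddCircle, ← UnitAddCircle.intervalIntegral_preimage 0]
  simp

lemma fourier_eq_e (n : ℤ) (t : ℝ) : fourier n (t : UnitAddCircle) = e (n * t) := by
  rw [fourier_coe_apply, e]
  congr 1
  push_cast
  ring

/-- The mean value as a continuous linear functional on `C(ℝ/ℤ, ℂ)`. -/
noncomputable def mean : C(UnitAddCircle, ℂ) →L[ℂ] ℂ :=
  LinearMap.mkContinuous
    { toFun := fun f => ∫ x, f x ∂(haarAddCircle (T := (1 : ℝ)))
      map_add' := fun f g => integral_add (integrable_haar f.continuous)
        (integrable_haar g.continuous)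
      map_smul' := fun c f => integral_const_mul c _ } 1 (fun f => by
        have h := norm_integral_le_of_norm_le_const (μ := haarAddCircle (T := (1 : ℝ)))
          (Filter.Eventually.of_forall fun x => f.norm_coe_le_norm x)
        simpa using h)

lemma mean_apply (f : C(UnitAddCircle, ℂ)) :
    mean f = ∫ x, f x ∂(haarAddCircle (T := (1 : ℝ))) := rfl

lemma mean_fourier (n : ℤ) : mean (fourier n) = if n = 0 then 1 else 0 := by
  have h := congrFun (fourierCoeff_fourier (T := (1 : ℝ)) n) 0
  rw [fourierCoeff] at h
  simp only [neg_zero, fourier_zero, one_smul, Pi.single_apply] at h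
  rw [mean_apply, h]
  simp [eq_comm]

lemma fourier_mul (m n : ℤ) :
    (fourier m * fourier n : C(UnitAddCircle, ℂ)) = fourier (m + n) := by
  ext x
  simp

lemma fourier_one_pow (k : ℕ) :
    (fourier 1 : C(UnitAddCircle, ℂ)) ^ k = fourier (k : ℤ) := by
  induction k with
  | zero => ext x; simp
  | succ k ih => rw [pow_succ, ih, fourier_mul]; push_cast; rfl

/-- The algebra of analytic trigonometric polynomials, those with frequencies `≥ 0`. -/
noncomputable def analyticPoly : Subalgebra ℂ C(UnitAddCircle, ℂ) :=
  Algebra.adjoin ℂ {fourier 1}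

lemma mem_analyticPoly {h : C(UnitAddCircle, ℂ)} :
    h ∈ analyticPoly ↔ ∃ p : ℂ[X], aeval (fourier 1 : C(UnitAddCircle, ℂ)) p = h := by
  rw [analyticPoly, Algebra.adjoin_singleton_eq_range_aeval]
  rfl

lemma fourier_mem_analyticPoly (k : ℕ) : fourier (k : ℤ) ∈ analyticPoly := by
  rw [← fourier_one_pow]
  exact pow_mem (Algebra.self_mem_adjoin_singleton ℂ _) k

/-- Averaging an analytic polynomial evaluates it at the origin; in particular the mean is
multiplicative on `analyticPoly`. -/
lemma mean_aeval (p : ℂ[X]) :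
    mean (aeval (fourier 1 : C(UnitAddCircle, ℂ)) p) = p.eval 0 := by
  induction p using Polynomial.induction_on' with
  | add p q hp hq => simp [hp, hq]
  | monomial n a =>
    rw [aeval_monomial, fourier_one_pow, ← Algebra.smul_def, map_smul, mean_fourier]
    rcases eq_or_ne n 0 with rfl | hn <;> simp [*]

lemma mean_sq {h : C(UnitAddCircle, ℂ)} (hh : h ∈ analyticPoly) :
    mean (h ^ 2) = mean h ^ 2 := by
  obtain ⟨p, rfl⟩ := mem_analyticPoly.1 hh
  rw [← map_pow, mean_aeval, mean_aeval, eval_pow]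

/-- Uniform limits of analytic polynomials have no negative frequencies. -/
lemma mean_fourier_mul_eq_zero {n : ℤ} (hn : 0 < n) {h : C(UnitAddCircle, ℂ)}
    (hh : h ∈ analyticPoly.topologicalClosure) : mean (fourier n * h) = 0 := by
  have hcl : IsClosed {h : C(UnitAddCircle, ℂ) | mean (fourier n * h) = 0} :=
    isClosed_eq (by fun_prop) continuous_const
  refine closure_minimal ?_ hcl hh
  intro h hh
  obtain ⟨p, rfl⟩ := mem_analyticPoly.1 hh
  have hn' : (fourier n : C(UnitAddCircle, ℂ)) = aeval (fourier 1) (X ^ n.toNat : ℂ[X]) := by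
    rw [map_pow, aeval_X, fourier_one_pow, Int.toNat_of_nonneg hn.le]
  have h0 : n.toNat ≠ 0 := by omega
  rw [Set.mem_ofPred_eq, hn', ← map_mul, mean_aeval]
  simp [h0]

/-- The exponential of a continuous function on the circle. -/
noncomputable def cexpMap (h : C(UnitAddCircle, ℂ)) : C(UnitAddCircle, ℂ) :=
  ⟨fun x => Complex.exp (h x), by fun_prop⟩

lemma cexpMap_mem {h : C(UnitAddCircle, ℂ)} (hh : h ∈ analyticPoly) :
    cexpMap h ∈ analyticPoly.topologicalClosure := by
  have h1 : cexpMap h = NormedSpace.exp h := by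
    ext x
    have := NormedSpace.map_exp (ContinuousMap.evalAlgHom ℂ ℂ x)
      (continuous_eval_const x) h
    simp only [ContinuousMap.evalAlgHom_apply] at this
    rw [this, ← Complex.exp_eq_exp_ℂ]
    rfl
  rw [h1]
  exact NormedSpace.exp_mem (R := ℂ) (Subalgebra.isClosed_topologicalClosure _)
    (Subalgebra.le_topologicalClosure _ hh)

lemma norm_exp_sub_one_le_of_re_nonpos {z : ℂ} (hz : z.re ≤ 0) : ‖Complex.exp z - 1‖ ≤ ‖z‖ := by
  have h := Convex.norm_image_sub_le_of_norm_hasDerivWithin_le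
    (f := Complex.exp) (f' := Complex.exp) (C := 1) (s := {w : ℂ | w.re ≤ 0}) (x := 0) (y := z)
    (fun w _ => (Complex.hasDerivAt_exp w).hasDerivWithinAt)
    (fun w hw => by
      rw [Complex.norm_exp]
      exact Real.exp_le_one_iff.2 hw)
    (convex_halfSpace_re_le 0) (by simp) hz
  simpa using h

/-- Negative frequencies can be reflected without changing the real part. -/
lemma exists_analyticPoly_re_eq {q : C(UnitAddCircle, ℂ)}
    (hq : q ∈ Submodule.span ℂ (Set.range (fourier (T := (1 : ℝ))))) :
    ∃ h ∈ analyticPoly, ∀ x, (h x).re = (q x).re := by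
  -- The statement is strengthened to all multiples `c • q`, so that it passes through scalars.
  refine Submodule.span_induction (p := fun q _ => ∀ c : ℂ, ∃ h ∈ analyticPoly,
    ∀ x, (h x).re = ((c • q) x).re) ?_ ?_ ?_ ?_ hq 1 |>.imp (by simp)
  · rintro _ ⟨n, rfl⟩ c
    rcases le_total 0 n with hn | hn
    · lift n to ℕ using hn
      exact ⟨_, analyticPoly.smul_mem (fourier_mem_analyticPoly n) c, fun x => rfl⟩
    · obtain ⟨k, rfl⟩ : ∃ k : ℕ, n = -k := ⟨(-n).toNat, by omega⟩
      refine ⟨_, analyticPoly.smul_mem (fourier_mem_analyticPoly k) (starRingEnd ℂ c), fun x => ?_⟩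
      simp only [ContinuousMap.smul_apply, smul_eq_mul, fourier_neg]
      simp
  · exact fun c => ⟨0, zero_mem _, by simp⟩
  · intro a b _ _ ha hb c
    obtain ⟨h, hh, h'⟩ := ha c
    obtain ⟨k, hk, k'⟩ := hb c
    exact ⟨h + k, add_mem hh hk, fun x => by
      rw [ContinuousMap.add_apply, Complex.add_re, h', k']
      exact (congrArg Complex.re (smul_add c (a x) (b x))).symm⟩
  · intro d a _ ha c
    obtain ⟨h, hh, h'⟩ := ha (c * d)
    exact ⟨h, hh, fun x => by rw [h', mul_smul]⟩

/-- The conjugate function of `Re h` is no larger than `Re h` in `L²`: since `∫ h² = (∫ h)² ≥ 0`,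
one has `∫ (Im h)² ≤ ∫ (Re h)²`. -/
lemma integral_norm_sq_le {h : C(UnitAddCircle, ℂ)} (hh : h ∈ analyticPoly)
    (him : (mean h).im = 0) :
    ∫ x, ‖h x‖ ^ 2 ∂(haarAddCircle (T := (1 : ℝ))) ≤
      2 * ∫ x, (h x).re ^ 2 ∂(haarAddCircle (T := (1 : ℝ))) := by
  have h1 : 0 ≤ (mean (h ^ 2)).re := by
    rw [mean_sq hh, sq, Complex.mul_re, him]
    nlinarith [sq_nonneg (mean h).re]
  have h2 : (mean (h ^ 2)).re = 2 * ∫ x, (h x).re ^ 2 ∂(haarAddCircle (T := (1 : ℝ))) -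
      ∫ x, ‖h x‖ ^ 2 ∂(haarAddCircle (T := (1 : ℝ))) := by
    rw [mean_apply, ← integral_const_mul, ← integral_sub (integrable_haar (by fun_prop))
      (integrable_haar (by fun_prop))]
    refine (integral_re (𝕜 := ℂ) (integrable_haar (h ^ 2).continuous)).symm.trans ?_
    congr 1
    ext x
    rw [← Complex.normSq_eq_norm_sq, Complex.normSq_apply]
    simp [sq]
    ring
  linarith

/-- Every continuous function is dominated by the real part of an analytic polynomial of
comparable `L²` norm. -/
lemma exists_analytic_majorant (g : C(UnitAddCircle, ℂ)) {η : ℝ} (hη : 0 < η) :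
    ∃ h ∈ analyticPoly, (∀ x, ‖g x‖ ≤ (h x).re) ∧
      ∫ x, ‖h x‖ ^ 2 ∂(haarAddCircle (T := (1 : ℝ))) ≤
        4 * ∫ x, ‖g x‖ ^ 2 ∂(haarAddCircle (T := (1 : ℝ))) + 4 * η ^ 2 := by
  -- Approximating `‖g‖ + η / 2` to within `η / 2` keeps the approximant above `‖g‖`.
  let G : C(UnitAddCircle, ℂ) := ⟨fun x => ((‖g x‖ + η / 2 : ℝ) : ℂ), by fun_prop⟩
  have hG : G ∈ (Submodule.span ℂ (Set.range (fourier (T := (1 : ℝ))))).topologicalClosure := by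
    rw [span_fourier_closure_eq_top]; trivial
  obtain ⟨q, hq, hqG⟩ := Metric.mem_closure_iff.1 hG (η / 2) (by positivity)
  obtain ⟨h₀, hh₀, hre⟩ := exists_analyticPoly_re_eq hq
  have hclose : ∀ x, ‖g x‖ ≤ (q x).re ∧ (q x).re ≤ ‖g x‖ + η := by
    intro x
    have h1 : |((G - q) x).re| ≤ η / 2 := by
      refine (Complex.abs_re_le_norm _).trans (((G - q).norm_coe_le_norm x).trans ?_)
      rw [← dist_eq_norm]; exact hqG.le
    have h2 : ((G - q) x).re = ‖g x‖ + η / 2 - (q x).re := by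
      simp [G]
    rw [h2, abs_le] at h1
    constructor <;> linarith
  -- An imaginary constant is subtracted to make the mean real.
  refine ⟨h₀ - algebraMap ℂ _ ((mean h₀).im * Complex.I),
    sub_mem hh₀ (analyticPoly.algebraMap_mem _), ?_, ?_⟩
  · intro x
    simpa [hre] using (hclose x).1
  · refine (integral_norm_sq_le (sub_mem hh₀ (analyticPoly.algebraMap_mem _)) ?_).trans ?_
    · have h1 : mean 1 = 1 := by simp [mean_apply]
      rw [Algebra.algebraMap_eq_smul_one, map_sub, map_smul, h1]
      simp
    · have : ∫ x, ((h₀ - algebraMap ℂ C(UnitAddCircle, ℂ) ((mean h₀).im * Complex.I)) x).re ^ 2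
          ∂(haarAddCircle (T := (1 : ℝ))) ≤
          ∫ x, (2 * ‖g x‖ ^ 2 + 2 * η ^ 2) ∂(haarAddCircle (T := (1 : ℝ))) := by
        refine integral_mono (integrable_haar (by fun_prop)) (integrable_haar (by fun_prop)) ?_
        intro x
        have h1 := hclose x
        have h2 : ((h₀ - algebraMap ℂ C(UnitAddCircle, ℂ) ((mean h₀).im * Complex.I)) x).re
          = (q x).re := by simp [hre]
        simp only [h2]
        nlinarith [norm_nonneg (g x), sq_nonneg (‖g x‖ - η)]
      rw [integral_add (integrable_haar (by fun_prop)) (integrable_haar (by fun_prop)),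
        integral_const_mul] at this
      simp only [integral_const, probReal_univ, one_smul] at this
      linarith

/-! ### The McGehee–Pigno–Smith inequality -/

lemma integral_norm_sq_sum_fourier {ι : Type*} [DecidableEq ι] (s : Finset ι) (b : ι → ℤ)
    (hb : Set.InjOn b s) (c : ι → ℂ) :
    ∫ x, ‖(∑ i ∈ s, c i • (fourier (b i) : C(UnitAddCircle, ℂ))) x‖ ^ 2
      ∂(haarAddCircle (T := (1 : ℝ))) = ∑ i ∈ s, ‖c i‖ ^ 2 := by
  set f : C(UnitAddCircle, ℂ) := ∑ i ∈ s, c i • fourier (b i) with hf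
  have h1 : mean (f * star f) =
      ((∫ x, ‖f x‖ ^ 2 ∂(haarAddCircle (T := (1 : ℝ))) : ℝ) : ℂ) := by
    rw [mean_apply, ← integral_complex_ofReal]
    congr 1
    ext x
    simp [Complex.mul_conj']
  have hstar : ∀ n : ℤ, star (fourier n : C(UnitAddCircle, ℂ)) = fourier (-n) := by
    intro n
    ext x
    rw [ContinuousMap.star_apply, fourier_neg]
    rfl
  have h2 : mean (f * star f) = ∑ i ∈ s, (‖c i‖ : ℂ) ^ 2 := by
    rw [hf, star_sum, Finset.sum_mul_sum, map_sum]
    refine Finset.sum_congr rfl fun i hi => ?_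
    rw [map_sum, Finset.sum_eq_single_of_mem i hi]
    · rw [star_smul, hstar, smul_mul_smul_comm, fourier_mul, map_smul, mean_fourier]
      simp [Complex.mul_conj']
    · intro j hj hji
      rw [star_smul, hstar, smul_mul_smul_comm, fourier_mul, map_smul, mean_fourier, if_neg,
        smul_zero]
      intro h
      exact hji (hb hj hi (by omega))
  have h3 := h1.symm.trans h2
  exact_mod_cast h3

/-- The `k`-th block `{j : 4 ^ k ≤ j + 1 < 4 ^ (k + 1)}` of indices; the shift by one is there
because `Fin N` starts at `0`. -/
def block (N k : ℕ) : Finset (Fin N) := {j | Nat.log 4 ((j : ℕ) + 1) = k}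

lemma mem_block {N k : ℕ} {j : Fin N} : j ∈ block N k ↔ Nat.log 4 ((j : ℕ) + 1) = k := by
  simp [block]

lemma card_block_le (N k : ℕ) : (block N k).card ≤ 3 * 4 ^ k := by
  have h : (block N k).card ≤ (Finset.Ico (4 ^ k) (4 ^ (k + 1))).card := by
    refine Finset.card_le_card_of_injOn (fun j => (j : ℕ) + 1) ?_ ?_
    · intro j hj
      have hj' := mem_block.1 (Finset.mem_coe.1 hj)
      rw [Finset.mem_coe, Finset.mem_Ico]
      subst hj'
      exact ⟨Nat.pow_log_le_self 4 (by omega), Nat.lt_pow_succ_log_self (by norm_num) _⟩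
    · intro i _ j _ hij
      exact Fin.ext (by simpa using hij)
  rw [Nat.card_Ico, pow_succ] at h
  omega

/-- The conjugate-frequency polynomial `4 ^ (-k) ∑ σ_j e(-a_j x)` over the `k`-th block. -/
noncomputable def blockPoly {N : ℕ} (a : Fin N → ℤ) (σ : Fin N → ℂ) (k : ℕ) :
    C(UnitAddCircle, ℂ) :=
  ∑ j ∈ block N k, (((4 : ℂ) ^ k)⁻¹ * σ j) • fourier (-a j)

section blocks

variable {N : ℕ} {a : Fin N → ℤ} {σ : Fin N → ℂ}

lemma norm_blockCoeff_le (hσ : ∀ j, ‖σ j‖ ≤ 1) (k : ℕ) (j : Fin N) :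
    ‖((4 : ℂ) ^ k)⁻¹ * σ j‖ ≤ ((4 : ℝ) ^ k)⁻¹ := by
  rw [norm_mul, norm_inv, norm_pow, RCLike.norm_ofNat]
  exact mul_le_of_le_one_right (by positivity) (hσ j)

lemma norm_blockPoly_le (hσ : ∀ j, ‖σ j‖ ≤ 1) (k : ℕ) (x : UnitAddCircle) :
    ‖blockPoly a σ k x‖ ≤ 3 := by
  have hc : ((block N k).card : ℝ) ≤ 3 * 4 ^ k := by exact_mod_cast card_block_le N k
  rw [blockPoly, ContinuousMap.sum_apply]
  refine (norm_sum_le_of_le _ (f := fun j => ((((4 : ℂ) ^ k)⁻¹ * σ j) •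
    (fourier (-a j) : C(UnitAddCircle, ℂ))) x) (n := fun _ => ((4 : ℝ) ^ k)⁻¹)
    fun j _ => ?_).trans ?_
  · rw [ContinuousMap.smul_apply, norm_smul, fourier_apply, Circle.norm_coe, mul_one]
    exact norm_blockCoeff_le hσ k j
  · rw [Finset.sum_const, nsmul_eq_mul, ← div_eq_mul_inv, div_le_iff₀ (by positivity)]
    exact hc

lemma integral_norm_sq_blockPoly_le (ha : Function.Injective a) (hσ : ∀ j, ‖σ j‖ ≤ 1) (k : ℕ) :
    ∫ x, ‖blockPoly a σ k x‖ ^ 2 ∂(haarAddCircle (T := (1 : ℝ))) ≤ 3 * ((4 : ℝ) ^ k)⁻¹ := by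
  have hc : ((block N k).card : ℝ) ≤ 3 * 4 ^ k := by exact_mod_cast card_block_le N k
  rw [blockPoly, integral_norm_sq_sum_fourier _ _ fun i _ j _ hij => ha (neg_injective hij)]
  calc ∑ j ∈ block N k, ‖((4 : ℂ) ^ k)⁻¹ * σ j‖ ^ 2
      ≤ ∑ j ∈ block N k, (((4 : ℝ) ^ k)⁻¹) ^ 2 :=
        Finset.sum_le_sum fun j _ => by gcongr; exact norm_blockCoeff_le hσ k j
    _ ≤ 3 * 4 ^ k * (((4 : ℝ) ^ k)⁻¹) ^ 2 := by
        rw [Finset.sum_const, nsmul_eq_mul]; gcongr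
    _ = 3 * ((4 : ℝ) ^ k)⁻¹ := by field_simp

lemma mean_fourier_mul_blockPoly (ha : Function.Injective a) (j : Fin N) (k : ℕ) :
    mean (fourier (a j) * blockPoly a σ k) =
      if Nat.log 4 ((j : ℕ) + 1) = k then ((4 : ℂ) ^ k)⁻¹ * σ j else 0 := by
  have h : ∀ i, mean (fourier (a j) * ((((4 : ℂ) ^ k)⁻¹ * σ i) • fourier (-a i))) =
      if i = j then ((4 : ℂ) ^ k)⁻¹ * σ j else 0 := by
    intro i
    rw [mul_smul_comm, fourier_mul, map_smul, mean_fourier]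
    by_cases hij : i = j
    · subst hij; simp
    · rw [if_neg hij, if_neg fun h => hij (ha (by omega)), smul_zero]
  rw [blockPoly, Finset.mul_sum, map_sum, Finset.sum_congr rfl fun i _ => h i,
    Finset.sum_ite_eq']
  simp [mem_block]

/-- Multiplication by a function with nonnegative frequencies moves the spectrum of an earlier
block away from the (negatives of the) frequencies of a later one. -/
lemma mean_fourier_mul_blockPoly_mul_eq_zero (ha : StrictMono a) {j : Fin N} {k : ℕ}
    (hk : k < Nat.log 4 ((j : ℕ) + 1)) {h : C(UnitAddCircle, ℂ)}
    (hh : h ∈ analyticPoly.topologicalClosure) :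
    mean (fourier (a j) * (blockPoly a σ k * h)) = 0 := by
  rw [blockPoly, Finset.sum_mul, Finset.mul_sum, map_sum]
  refine Finset.sum_eq_zero fun i hi => ?_
  rw [smul_mul_assoc, mul_smul_comm, ← mul_assoc, fourier_mul, map_smul,
    mean_fourier_mul_eq_zero ?_ hh, smul_zero]
  rw [mem_block] at hi
  have hij : i < j := by
    by_contra hij
    have := Nat.log_mono_right (b := 4) (show (j : ℕ) + 1 ≤ (i : ℕ) + 1 by simpa using hij)
    omega
  have := ha hij
  omega

end blocks

lemma norm_mean_mul_le (n : ℤ) (g r : C(UnitAddCircle, ℂ)) :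
    ‖mean (fourier n * (g * r))‖ ≤ ∫ x, ‖g x‖ * ‖r x‖ ∂(haarAddCircle (T := (1 : ℝ))) := by
  rw [mean_apply]
  refine (norm_integral_le_integral_norm _).trans (le_of_eq ?_)
  congr 1
  ext x
  rw [ContinuousMap.mul_apply, norm_mul, fourier_apply, Circle.norm_coe, one_mul,
    ContinuousMap.mul_apply, norm_mul]

/-- Cauchy–Schwarz in the scale-invariant form needed for geometrically decaying `L²` norms. -/
lemma integral_norm_mul_norm_le (g h : C(UnitAddCircle, ℂ)) {G H α β : ℝ} (hα : 0 < α)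
    (hβ : 0 < β)
    (hg : ∫ x, ‖g x‖ ^ 2 ∂(haarAddCircle (T := (1 : ℝ))) ≤ G * α ^ 2)
    (hh : ∫ x, ‖h x‖ ^ 2 ∂(haarAddCircle (T := (1 : ℝ))) ≤ H * β ^ 2) :
    ∫ x, ‖g x‖ * ‖h x‖ ∂(haarAddCircle (T := (1 : ℝ))) ≤ (G + H) / 2 * (α * β) := by
  have h1 : ∫ x, ‖g x‖ * ‖h x‖ ∂(haarAddCircle (T := (1 : ℝ))) ≤
      ∫ x, (β / (2 * α) * ‖g x‖ ^ 2 + α / (2 * β) * ‖h x‖ ^ 2)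
        ∂(haarAddCircle (T := (1 : ℝ))) := by
    refine integral_mono (integrable_haar (by fun_prop)) (integrable_haar (by fun_prop)) ?_
    intro x
    have h2 : β / (2 * α) * ‖g x‖ ^ 2 + α / (2 * β) * ‖h x‖ ^ 2 - ‖g x‖ * ‖h x‖ =
        (β * ‖g x‖ - α * ‖h x‖) ^ 2 / (2 * α * β) := by
      field_simp
      ring
    have h3 : 0 ≤ (β * ‖g x‖ - α * ‖h x‖) ^ 2 / (2 * α * β) := by positivity
    show ‖g x‖ * ‖h x‖ ≤ β / (2 * α) * ‖g x‖ ^ 2 + α / (2 * β) * ‖h x‖ ^ 2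
    linarith
  rw [integral_add (integrable_haar (by fun_prop)) (integrable_haar (by fun_prop)),
    integral_const_mul, integral_const_mul] at h1
  calc _ ≤ _ := h1
    _ ≤ β / (2 * α) * (G * α ^ 2) + α / (2 * β) * (H * β ^ 2) := by gcongr
    _ = (G + H) / 2 * (α * β) := by field_simp

/-- The test function `∑_{k < n} g_k exp(-(h_{k+1} + ⋯ + h_{n-1}) / 28)`. The factor `1 / 28` is
small enough for the perturbation of each Fourier coefficient to stay below half of it. -/
noncomputable def testFun (g h : ℕ → C(UnitAddCircle, ℂ)) (n : ℕ) : C(UnitAddCircle, ℂ) :=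
  ∑ k ∈ Finset.range n, g k * cexpMap (-(1 / 28 : ℂ) • ∑ m ∈ Finset.Ico (k + 1) n, h m)

lemma testFun_succ_apply (g h : ℕ → C(UnitAddCircle, ℂ)) (n : ℕ) (x : UnitAddCircle) :
    testFun g h (n + 1) x = testFun g h n x * Complex.exp (-(1 / 28 : ℂ) * h n x) + g n x := by
  rw [testFun, testFun, Finset.sum_range_succ, ContinuousMap.add_apply]
  congr 1
  · rw [ContinuousMap.sum_apply, ContinuousMap.sum_apply, Finset.sum_mul]
    refine Finset.sum_congr rfl fun k hk => ?_
    rw [Finset.sum_Ico_succ_top (by simpa using hk)]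
    simp only [cexpMap, ContinuousMap.mul_apply, ContinuousMap.coe_mk, ContinuousMap.smul_apply,
      ContinuousMap.add_apply, smul_eq_mul, mul_add, Complex.exp_add]
    ring
  · simp [cexpMap]

/-- The bound `31 = 28 + 3` is preserved at each step, since
`31 exp(-x / 28) + x ≤ 31 / (1 + x / 28) + x ≤ 31` for `0 ≤ x ≤ 3`. -/
lemma norm_testFun_le {g h : ℕ → C(UnitAddCircle, ℂ)} (hg : ∀ k x, ‖g k x‖ ≤ 3)
    (hgh : ∀ k x, ‖g k x‖ ≤ (h k x).re) (n : ℕ) (x : UnitAddCircle) :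
    ‖testFun g h n x‖ ≤ 31 := by
  induction n with
  | zero => simp [testFun]
  | succ n ih =>
    rw [testFun_succ_apply]
    refine (norm_add_le _ _).trans ?_
    rw [norm_mul, Complex.norm_exp]
    have h1 := hg n x
    have h2 := hgh n x
    have h0 := norm_nonneg (g n x)
    have h3 : (-(1 / 28 : ℂ) * h n x).re = -((h n x).re / 28) := by
      have : (-(1 / 28 : ℂ) * h n x) = ((-(1 / 28) : ℝ) : ℂ) * h n x := by push_cast; ring
      rw [this, Complex.re_ofReal_mul]; ring
    rw [h3]
    have h4 : Real.exp (-((h n x).re / 28)) ≤ (1 + ‖g n x‖ / 28)⁻¹ := by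
      rw [Real.exp_neg]
      apply inv_anti₀ (by positivity)
      have := Real.add_one_le_exp ((h n x).re / 28)
      linarith
    have h5 : ‖testFun g h n x‖ * Real.exp (-((h n x).re / 28)) ≤
        31 * (1 + ‖g n x‖ / 28)⁻¹ := by gcongr
    have h6 : 31 * (1 + ‖g n x‖ / 28)⁻¹ + ‖g n x‖ ≤ 31 := by
      rw [← div_eq_mul_inv, ← le_sub_iff_add_le, div_le_iff₀ (by positivity)]
      nlinarith
    linarith

lemma sum_inv_two_pow_Ico_le (k n : ℕ) :
    ∑ m ∈ Finset.Ico (k + 1) n, ((2 : ℝ) ^ m)⁻¹ ≤ ((2 : ℝ) ^ k)⁻¹ := by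
  rcases le_or_gt n k with hn | hn
  · rw [Finset.Ico_eq_empty (by omega)]
    simp
  · have h : ∀ n, k + 1 ≤ n → ∑ m ∈ Finset.Ico (k + 1) n, ((2 : ℝ) ^ m)⁻¹ =
        ((2 : ℝ) ^ k)⁻¹ - 2 * ((2 : ℝ) ^ n)⁻¹ := by
      intro n hn
      induction n, hn using Nat.le_induction with
      | base => simp [pow_succ]
      | succ n hn ih => rw [Finset.sum_Ico_succ_top hn, ih, pow_succ]; field_simp; ring
    rw [h n hn]
    have : (0 : ℝ) < ((2 : ℝ) ^ n)⁻¹ := by positivity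
    linarith

lemma sum_inv_four_pow_Ico_le (l n : ℕ) :
    ∑ k ∈ Finset.Ico l n, ((4 : ℝ) ^ k)⁻¹ ≤ 4 / 3 * ((4 : ℝ) ^ l)⁻¹ := by
  rcases le_or_gt n l with hn | hn
  · rw [Finset.Ico_eq_empty (by omega)]
    simp
  · have h : ∀ n, l ≤ n → ∑ k ∈ Finset.Ico l n, ((4 : ℝ) ^ k)⁻¹ =
        4 / 3 * (((4 : ℝ) ^ l)⁻¹ - ((4 : ℝ) ^ n)⁻¹) := by
      intro n hn
      induction n, hn using Nat.le_induction with
      | base => simp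
      | succ n hn ih => rw [Finset.sum_Ico_succ_top hn, ih, pow_succ]; field_simp; ring
    rw [h n hn.le]
    have : (0 : ℝ) < ((4 : ℝ) ^ n)⁻¹ := by positivity
    linarith

/-- The exponential factor attached to the `k`-th block changes each Fourier coefficient by
`O(4 ^ (-k))`, because `|exp z - 1| ≤ |z|` for `Re z ≤ 0` and both `L²` norms decay
geometrically. -/
lemma norm_mean_mul_cexpMap_sub_one_le {g : C(UnitAddCircle, ℂ)} {h : ℕ → C(UnitAddCircle, ℂ)}
    {k : ℕ} (n : ℕ) (q : ℤ)
    (hg : ∫ x, ‖g x‖ ^ 2 ∂(haarAddCircle (T := (1 : ℝ))) ≤ 3 * ((4 : ℝ) ^ k)⁻¹)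
    (hh : ∀ m, ∫ x, ‖h m x‖ ^ 2 ∂(haarAddCircle (T := (1 : ℝ))) ≤ 16 * ((4 : ℝ) ^ m)⁻¹)
    (hre : ∀ m x, 0 ≤ (h m x).re) :
    ‖mean (fourier q * (g * (cexpMap (-(1 / 28 : ℂ) • ∑ m ∈ Finset.Ico (k + 1) n, h m) - 1)))‖ ≤
      19 / 56 * ((4 : ℝ) ^ k)⁻¹ := by
  refine (norm_mean_mul_le q g _).trans ?_
  have h4 : ∀ m : ℕ, ((4 : ℝ) ^ m)⁻¹ = (((2 : ℝ) ^ m)⁻¹) ^ 2 := by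
    intro m; rw [inv_pow, ← pow_mul, mul_comm, pow_mul]; norm_num
  have hpt : ∀ x, ‖g x‖ * ‖(cexpMap (-(1 / 28 : ℂ) • ∑ m ∈ Finset.Ico (k + 1) n, h m) - 1) x‖ ≤
      1 / 28 * ∑ m ∈ Finset.Ico (k + 1) n, ‖g x‖ * ‖h m x‖ := by
    intro x
    have h1 : ‖(cexpMap (-(1 / 28 : ℂ) • ∑ m ∈ Finset.Ico (k + 1) n, h m) - 1) x‖ ≤
        1 / 28 * ∑ m ∈ Finset.Ico (k + 1) n, ‖h m x‖ := by
      have hz : ((-(1 / 28 : ℂ) • ∑ m ∈ Finset.Ico (k + 1) n, h m) x) =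
          ((-(1 / 28) : ℝ) : ℂ) * ∑ m ∈ Finset.Ico (k + 1) n, h m x := by
        simp
      refine (norm_exp_sub_one_le_of_re_nonpos ?_).trans ?_
      · rw [hz, Complex.re_ofReal_mul, Complex.re_sum]
        have := Finset.sum_nonneg fun m (_ : m ∈ Finset.Ico (k + 1) n) => hre m x
        linarith
      · rw [hz, norm_mul, Complex.norm_real]
        have : ‖(-(1 / 28) : ℝ)‖ = 1 / 28 := by norm_num
        rw [this]
        gcongr
        exact norm_sum_le _ _
    rw [← Finset.mul_sum]
    calc _ ≤ ‖g x‖ * (1 / 28 * ∑ m ∈ Finset.Ico (k + 1) n, ‖h m x‖) := by gcongr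
      _ = _ := by ring
  calc _ ≤ ∫ x, 1 / 28 * ∑ m ∈ Finset.Ico (k + 1) n, ‖g x‖ * ‖h m x‖
        ∂(haarAddCircle (T := (1 : ℝ))) :=
        integral_mono (integrable_haar (by fun_prop)) (integrable_haar (by fun_prop)) hpt
    _ = 1 / 28 * ∑ m ∈ Finset.Ico (k + 1) n,
        ∫ x, ‖g x‖ * ‖h m x‖ ∂(haarAddCircle (T := (1 : ℝ))) := by
        rw [integral_const_mul, integral_finsetSum _ fun m _ => integrable_haar (by fun_prop)]
    _ ≤ 1 / 28 * ∑ m ∈ Finset.Ico (k + 1) n,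
        (3 + 16) / 2 * (((2 : ℝ) ^ k)⁻¹ * ((2 : ℝ) ^ m)⁻¹) := by
        gcongr with m hm
        exact integral_norm_mul_norm_le g (h m) (by positivity) (by positivity)
          (by rw [← h4]; exact hg) (by rw [← h4]; exact hh m)
    _ = 19 / 56 * ((2 : ℝ) ^ k)⁻¹ * ∑ m ∈ Finset.Ico (k + 1) n, ((2 : ℝ) ^ m)⁻¹ := by
        rw [← Finset.mul_sum, ← Finset.mul_sum]; ring
    _ ≤ 19 / 56 * ((2 : ℝ) ^ k)⁻¹ * ((2 : ℝ) ^ k)⁻¹ := by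
        gcongr; exact sum_inv_two_pow_Ico_le k n
    _ = _ := by rw [h4]; ring

/-- The Fourier coefficients of the test function at the frequencies `a j`. Blocks before that of
`j` contribute nothing, and the later ones a geometric series. -/
lemma norm_mean_mul_testFun_sub_le {N : ℕ} {a : Fin N → ℤ} {σ : Fin N → ℂ} (ha : StrictMono a)
    (hσ : ∀ j, ‖σ j‖ ≤ 1) {h : ℕ → C(UnitAddCircle, ℂ)} (hmem : ∀ m, h m ∈ analyticPoly)
    (hh : ∀ m, ∫ x, ‖h m x‖ ^ 2 ∂(haarAddCircle (T := (1 : ℝ))) ≤ 16 * ((4 : ℝ) ^ m)⁻¹)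
    (hre : ∀ m x, 0 ≤ (h m x).re) (j : Fin N) {n : ℕ} (hn : N ≤ n) :
    ‖mean (fourier (a j) * testFun (blockPoly a σ) h n) -
      ((4 : ℂ) ^ Nat.log 4 ((j : ℕ) + 1))⁻¹ * σ j‖ ≤
      1 / 2 * ((4 : ℝ) ^ Nat.log 4 ((j : ℕ) + 1))⁻¹ := by
  set l := Nat.log 4 ((j : ℕ) + 1) with hl
  have hln : l < n := by
    have := Nat.log_lt_self 4 (show (j : ℕ) + 1 ≠ 0 by omega)
    have := j.isLt
    omega
  let E : ℕ → C(UnitAddCircle, ℂ) := fun k =>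
    cexpMap (-(1 / 28 : ℂ) • ∑ m ∈ Finset.Ico (k + 1) n, h m)
  have hE : ∀ k, E k ∈ analyticPoly.topologicalClosure := fun k =>
    cexpMap_mem (analyticPoly.smul_mem (sum_mem fun m _ => hmem m) _)
  have hmain : mean (fourier (a j) * testFun (blockPoly a σ) h n) -
      ((4 : ℂ) ^ l)⁻¹ * σ j =
      ∑ k ∈ Finset.Ico l n, mean (fourier (a j) * (blockPoly a σ k * (E k - 1))) := by
    have h1 : mean (fourier (a j) * testFun (blockPoly a σ) h n) =
        ∑ k ∈ Finset.Ico l n, mean (fourier (a j) * (blockPoly a σ k * E k)) := by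
      rw [testFun, Finset.mul_sum, map_sum, Finset.range_eq_Ico,
        ← Finset.sum_Ico_consecutive _ (Nat.zero_le l) hln.le,
        Finset.sum_eq_zero, zero_add]
      intro k hk
      exact mean_fourier_mul_blockPoly_mul_eq_zero ha (Finset.mem_Ico.1 hk).2 (hE k)
    have h2 : ((4 : ℂ) ^ l)⁻¹ * σ j =
        ∑ k ∈ Finset.Ico l n, mean (fourier (a j) * blockPoly a σ k) := by
      simp_rw [mean_fourier_mul_blockPoly ha.injective]
      rw [Finset.sum_ite_eq, if_pos (Finset.mem_Ico.2 ⟨le_rfl, hln⟩)]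
    rw [h1, h2, ← Finset.sum_sub_distrib]
    refine Finset.sum_congr rfl fun k _ => ?_
    rw [← map_sub]
    congr 1
    ring
  rw [hmain]
  calc _ ≤ ∑ k ∈ Finset.Ico l n, 19 / 56 * ((4 : ℝ) ^ k)⁻¹ :=
        norm_sum_le_of_le _ fun k _ => norm_mean_mul_cexpMap_sub_one_le n (a j)
          (integral_norm_sq_blockPoly_le ha.injective hσ k) hh hre
    _ ≤ 19 / 56 * (4 / 3 * ((4 : ℝ) ^ l)⁻¹) := by
        rw [← Finset.mul_sum]; gcongr; exact sum_inv_four_pow_Ico_le l n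
    _ ≤ 1 / 2 * ((4 : ℝ) ^ l)⁻¹ := by
        have : (0 : ℝ) < ((4 : ℝ) ^ l)⁻¹ := by positivity
        linarith

/-- The McGehee–Pigno–Smith inequality. -/
theorem isMPSConstant_one_div_sixtyTwo : IsMPSConstant (1 / 62) := by
  intro N a u ha
  -- When `u j = 0` this is `0 / 0 = 0`, which still satisfies both properties below.
  let σ : Fin N → ℂ := fun j => starRingEnd ℂ (u j) / ‖u j‖
  have hσ : ∀ j, ‖σ j‖ ≤ 1 := fun j => by
    simp only [σ, norm_div, RCLike.norm_conj, Complex.norm_real, norm_norm]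
    exact div_self_le_one _
  have hσu : ∀ j, u j * σ j = ‖u j‖ := fun j => by
    rcases eq_or_ne (u j) 0 with h | h
    · simp [h]
    · have : (‖u j‖ : ℂ) ≠ 0 := by simpa using h
      simp only [σ]
      rw [← mul_div_assoc, Complex.mul_conj', sq, mul_div_assoc, div_self this, mul_one]
  choose h hmem hgh hh using fun k : ℕ =>
    exists_analytic_majorant (blockPoly a σ k) (η := ((2 : ℝ) ^ k)⁻¹) (by positivity)
  have h4 : ∀ m : ℕ, ((4 : ℝ) ^ m)⁻¹ = (((2 : ℝ) ^ m)⁻¹) ^ 2 := by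
    intro m; rw [inv_pow, ← pow_mul, mul_comm, pow_mul]; norm_num
  have hh' : ∀ m, ∫ x, ‖h m x‖ ^ 2 ∂(haarAddCircle (T := (1 : ℝ))) ≤ 16 * ((4 : ℝ) ^ m)⁻¹ := by
    intro m
    have h1 := hh m
    have h2 := integral_norm_sq_blockPoly_le ha.injective hσ m
    rw [← h4] at h1
    linarith
  set Φ := testFun (blockPoly a σ) h N with hΦ
  have hcoef := fun j => norm_mean_mul_testFun_sub_le ha hσ hmem hh'
    (fun m x => (norm_nonneg _).trans (hgh m x)) j le_rfl
  rw [← hΦ] at hcoef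
  have hbd : ∀ x, ‖Φ x‖ ≤ 31 := norm_testFun_le (norm_blockPoly_le hσ) hgh N
  let f : C(UnitAddCircle, ℂ) := ∑ j, u j • fourier (a j)
  have hf : ∫ x, ‖f x‖ ∂(haarAddCircle (T := (1 : ℝ))) =
      ∫ t in (0 : ℝ)..1, ‖∑ j : Fin N, u j * e ((a j : ℝ) * t)‖ := by
    rw [integral_haar_eq_intervalIntegral]
    congr 1
    ext t
    simp only [f, ContinuousMap.sum_apply, ContinuousMap.smul_apply, fourier_eq_e, smul_eq_mul]
  have hupper : ‖mean (f * Φ)‖ ≤ 31 * ∫ x, ‖f x‖ ∂(haarAddCircle (T := (1 : ℝ))) := by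
    rw [mean_apply, ← integral_const_mul]
    refine (norm_integral_le_integral_norm _).trans
      (integral_mono (integrable_haar (by fun_prop)) (integrable_haar (by fun_prop)) fun x => ?_)
    simp only [ContinuousMap.mul_apply, norm_mul]
    rw [mul_comm]
    gcongr
    exact hbd x
  have hlower : ∑ j, 1 / 2 * (‖u j‖ / (((j : ℕ) : ℝ) + 1)) ≤ (mean (f * Φ)).re := by
    have h1 : mean (f * Φ) = ∑ j, u j * mean (fourier (a j) * Φ) := by
      simp only [f, Finset.sum_mul, map_sum, smul_mul_assoc, map_smul, smul_eq_mul]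
    rw [h1, Complex.re_sum]
    refine Finset.sum_le_sum fun j _ => ?_
    set l := Nat.log 4 ((j : ℕ) + 1) with hl
    have h2 : u j * mean (fourier (a j) * Φ) = ((((4 : ℝ) ^ l)⁻¹ * ‖u j‖ : ℝ) : ℂ) +
        u j * (mean (fourier (a j) * Φ) - ((4 : ℂ) ^ l)⁻¹ * σ j) := by
      push_cast
      rw [← hσu j]
      ring
    have h3 : -(‖u j‖ * (1 / 2 * ((4 : ℝ) ^ l)⁻¹)) ≤
        (u j * (mean (fourier (a j) * Φ) - ((4 : ℂ) ^ l)⁻¹ * σ j)).re := by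
      refine (neg_le_neg ?_).trans (abs_le.1 (Complex.abs_re_le_norm _)).1
      rw [norm_mul]
      gcongr
      exact hcoef j
    have h5 : (((j : ℕ) : ℝ) + 1)⁻¹ ≤ ((4 : ℝ) ^ l)⁻¹ := by
      apply inv_anti₀ (by positivity)
      exact_mod_cast Nat.pow_log_le_self 4 (show (j : ℕ) + 1 ≠ 0 by omega)
    rw [h2, Complex.add_re, Complex.ofReal_re, div_eq_mul_inv ‖u j‖]
    have h6 := mul_le_mul_of_nonneg_left h5 (norm_nonneg (u j))
    linarith
  have h7 := hlower.trans ((Complex.re_le_norm _).trans hupper)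
  rw [← Finset.mul_sum, hf] at h7
  linarith

/-! ### The trapezoidal kernel and sampling -/

lemma e_add (x y : ℝ) : e (x + y) = e x * e y := by
  rw [e, e, e, ← Complex.exp_add]
  push_cast
  ring_nf

lemma e_int (n : ℤ) : e n = 1 := by
  rw [e, Complex.exp_eq_one_iff]
  exact ⟨n, by push_cast; ring⟩

lemma e_zero : e 0 = 1 := by simp [e]

lemma norm_e (x : ℝ) : ‖e x‖ = 1 := by
  have : (2 * (Real.pi : ℂ) * Complex.I * (x : ℂ)) = ((2 * Real.pi * x : ℝ) : ℂ) * Complex.I := by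
    push_cast; ring
  rw [e, this, Complex.norm_exp_ofReal_mul_I]

lemma e_neg (x : ℝ) : e (-x) = starRingEnd ℂ (e x) := by
  rw [e, e, ← Complex.exp_conj]
  simp [map_ofNat]

lemma e_nat_mul (n : ℕ) (x : ℝ) : e (n * x) = e x ^ n := by
  rw [e, e, ← Complex.exp_nat_mul]
  push_cast
  ring_nf

@[fun_prop]
lemma continuous_e : Continuous e := by
  unfold e
  fun_prop

lemma sum_e_mul_div_eq_zero {D : ℕ} {m : ℤ} (hm : m ≠ 0) (hmD : |m| < D) :
    ∑ l ∈ Finset.range D, e (m * (l / D)) = 0 := by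
  have hD : (D : ℝ) ≠ 0 := by
    have : (0 : ℤ) < D := (abs_nonneg m).trans_lt hmD
    exact_mod_cast this.ne'
  have h1 : ∀ l ∈ Finset.range D, e (m * (l / D)) = e (m / D) ^ l := by
    intro l _
    rw [← e_nat_mul]
    congr 1
    ring
  rw [Finset.sum_congr rfl h1]
  have h2 : e (m / D) ≠ 1 := by
    intro h
    rw [e, Complex.exp_eq_one_iff] at h
    obtain ⟨q, hq⟩ := h
    have h3 : ((m / D : ℝ) : ℂ) = q := by
      have h4 : (2 * (Real.pi : ℂ) * Complex.I) ≠ 0 := Complex.two_pi_I_ne_zero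
      exact mul_left_cancel₀ h4 (by rw [hq]; ring)
    have h5 : (m / D : ℝ) = q := by exact_mod_cast h3
    rw [div_eq_iff hD] at h5
    have h6 : m = q * D := by exact_mod_cast h5
    exact hm (Int.eq_zero_of_abs_lt_dvd ⟨q, by rw [h6, mul_comm]⟩ hmD)
  have h3 := geom_sum_mul (e (m / D)) D
  rw [← e_nat_mul, mul_div_cancel₀ _ hD, e_int, sub_self] at h3
  exact (mul_eq_zero.1 h3).resolve_right (sub_ne_zero.2 h2)

/-- The one-sided Dirichlet kernel `∑_{0 ≤ i < L} e(ix)`. -/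
noncomputable def dirichlet (L : ℕ) (x : ℝ) : ℂ := ∑ i ∈ Finset.range L, e (i * x)

@[fun_prop]
lemma continuous_dirichlet (L : ℕ) : Continuous (dirichlet L) := by
  unfold dirichlet
  fun_prop

lemma norm_dirichlet_le (L : ℕ) (x : ℝ) : ‖dirichlet L x‖ ≤ L := by
  refine (norm_sum_le _ _).trans ?_
  simp [norm_e]

lemma norm_dirichlet_neg (L : ℕ) (x : ℝ) : ‖dirichlet L (-x)‖ = ‖dirichlet L x‖ := by
  simp only [dirichlet, mul_neg, e_neg]
  rw [← map_sum, RCLike.norm_conj]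

lemma norm_dirichlet_le_inv (L : ℕ) {x : ℝ} (hx : 0 < x) (hx' : x ≤ 1 / 2) :
    ‖dirichlet L x‖ ≤ (2 * x)⁻¹ := by
  have h1 : dirichlet L x * (e x - 1) = e x ^ L - 1 := by
    rw [← geom_sum_mul]
    simp only [dirichlet, e_nat_mul]
  have h2 : 4 * x ≤ ‖e x - 1‖ := by
    have : e x = Complex.exp (Complex.I * ((2 * Real.pi * x : ℝ) : ℂ)) := by
      rw [e]; push_cast; ring_nf
    rw [this, Complex.norm_exp_I_mul_ofReal_sub_one]
    have h3 := Real.mul_le_sin (x := Real.pi * x) (by positivity)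
      (by nlinarith [Real.pi_pos])
    have h4 : 2 / Real.pi * (Real.pi * x) = 2 * x := by field_simp
    rw [h4] at h3
    have h5 : 2 * Real.pi * x / 2 = Real.pi * x := by ring
    rw [h5]
    refine le_trans ?_ (le_abs_self _)
    linarith
  have h3 : ‖dirichlet L x‖ * ‖e x - 1‖ ≤ 2 := by
    rw [← norm_mul, h1]
    refine (norm_sub_le _ _).trans ?_
    rw [norm_pow, norm_e]
    norm_num
  rw [← one_div, le_div_iff₀ (by positivity)]
  nlinarith [norm_nonneg (dirichlet L x)]

/-- The trapezoidal (de la Vallée-Poussin type) kernel: its Fourier coefficients are `1` on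
`[-d, d]` and vanish outside `(-(K + d), K + d)`. -/
noncomputable def trapezoid (d K : ℕ) (x : ℝ) : ℂ :=
  (K : ℂ)⁻¹ * e (-(((K : ℤ) - 1 + d : ℤ) : ℝ) * x) * (dirichlet (K + 2 * d) x * dirichlet K x)

@[fun_prop]
lemma continuous_trapezoid (d K : ℕ) : Continuous (trapezoid d K) := by
  unfold trapezoid
  fun_prop

lemma norm_trapezoid (d K : ℕ) (x : ℝ) :
    ‖trapezoid d K x‖ = (K : ℝ)⁻¹ * (‖dirichlet (K + 2 * d) x‖ * ‖dirichlet K x‖) := by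
  rw [trapezoid, norm_mul, norm_mul, norm_mul, norm_e, mul_one, norm_inv, Complex.norm_natCast]

lemma e_int_mul_periodic (n : ℤ) (x : ℝ) : e (n * (x + 1)) = e (n * x) := by
  rw [mul_add, mul_one, e_add, e_int, mul_one]

lemma trapezoid_periodic (d K : ℕ) : Function.Periodic (trapezoid d K) 1 := by
  intro x
  have h : ∀ L, dirichlet L (x + 1) = dirichlet L x := fun L =>
    Finset.sum_congr rfl fun i _ => by exact_mod_cast e_int_mul_periodic i x
  rw [trapezoid, trapezoid, h, h]
  congr 2
  exact_mod_cast e_int_mul_periodic (-((K : ℤ) - 1 + d)) x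

lemma integral_norm_trapezoid_le (d : ℕ) {K : ℕ} (hK : 0 < K) :
    ∫ x in (0 : ℝ)..1, ‖trapezoid d K x‖ ≤ 2 + Real.log (1 + 2 * d / K) := by
  have hint : ∀ a b : ℝ, IntervalIntegrable (fun x => ‖trapezoid d K x‖) volume a b :=
    fun a b => Continuous.intervalIntegrable (by fun_prop) a b
  -- The kernel is even and periodic in absolute value. On `[0, 1 / 2]` each Dirichlet factor is at
  -- most its length and at most `1 / (2x)`; the two bounds cross at `α` and `β` respectively.
  have hhalf : ∫ x in (0 : ℝ)..1, ‖trapezoid d K x‖ =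
      2 * ∫ x in (0 : ℝ)..(1 / 2), ‖trapezoid d K x‖ := by
    have hper : Function.Periodic (fun x => ‖trapezoid d K x‖) 1 := fun x => by
      simp only [trapezoid_periodic d K x]
    have h1 := hper.intervalIntegral_add_eq 0 (-(1 / 2))
    rw [zero_add, show -(1 / 2 : ℝ) + 1 = 1 / 2 by norm_num] at h1
    rw [h1, ← intervalIntegral.integral_add_adjacent_intervals (hint _ 0) (hint 0 _)]
    have h2 : ∫ x in (-(1 / 2) : ℝ)..0, ‖trapezoid d K x‖ =
        ∫ x in (0 : ℝ)..(1 / 2), ‖trapezoid d K x‖ := by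
      have h3 := intervalIntegral.integral_comp_neg (a := 0) (b := 1 / 2)
        (fun x => ‖trapezoid d K x‖)
      rw [neg_zero] at h3
      rw [← h3]
      simp only [norm_trapezoid, norm_dirichlet_neg]
    rw [h2]
    ring
  set D : ℕ := K + 2 * d with hD
  have hK' : (1 : ℝ) ≤ K := by exact_mod_cast hK
  have hKD : (K : ℝ) ≤ D := by rw [hD]; push_cast; linarith [(Nat.cast_nonneg d : (0 : ℝ) ≤ d)]
  have hD0 : (0 : ℝ) < D := by linarith
  have hK0 : (0 : ℝ) < K := by linarith
  set α : ℝ := (2 * D)⁻¹ with hα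
  set β : ℝ := (2 * K)⁻¹ with hβ
  have hα0 : 0 < α := by positivity
  have hβ0 : 0 < β := by positivity
  have hαβ : α ≤ β := by rw [hα, hβ]; gcongr
  have hβh : β ≤ 1 / 2 := by
    rw [hβ, one_div]
    apply inv_anti₀ <;> linarith
  have hnear : ∫ x in (0 : ℝ)..α, ‖trapezoid d K x‖ ≤ 1 / 2 := by
    have h1 : ∫ x in (0 : ℝ)..α, ‖trapezoid d K x‖ ≤ ∫ _ in (0 : ℝ)..α, (D : ℝ) := by
      refine intervalIntegral.integral_mono_on hα0.le (hint _ _) (by simp) fun x _ => ?_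
      rw [norm_trapezoid, inv_mul_le_iff₀ hK0, mul_comm (K : ℝ)]
      exact mul_le_mul (norm_dirichlet_le _ _) (norm_dirichlet_le _ _) (norm_nonneg _) hD0.le
    rw [intervalIntegral.integral_const, hα] at h1
    have h2 : ((2 * D : ℝ)⁻¹ - 0) • (D : ℝ) = 1 / 2 := by
      rw [smul_eq_mul]; field_simp; ring
    exact h1.trans h2.le
  have hmid : ∫ x in α..β, ‖trapezoid d K x‖ ≤ 1 / 2 * Real.log (D / K) := by
    have hi : IntervalIntegrable (fun x : ℝ => x⁻¹) volume α β :=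
      intervalIntegral.intervalIntegrable_inv (fun x hx => by
        rw [Set.uIcc_of_le hαβ] at hx; exact (hα0.trans_le hx.1).ne') continuousOn_id
    have h1 : ∫ x in α..β, ‖trapezoid d K x‖ ≤ ∫ x in α..β, 1 / 2 * x⁻¹ := by
      refine intervalIntegral.integral_mono_on hαβ (hint _ _) (hi.const_mul _) fun x hx => ?_
      have hx0 : 0 < x := hα0.trans_le hx.1
      rw [norm_trapezoid, inv_mul_le_iff₀ hK0]
      calc _ ≤ (2 * x)⁻¹ * K := mul_le_mul (norm_dirichlet_le_inv _ hx0 (hx.2.trans hβh))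
              (norm_dirichlet_le _ _) (norm_nonneg _) (by positivity)
        _ = _ := by rw [mul_inv]; ring
    rw [intervalIntegral.integral_const_mul, integral_inv_of_pos hα0 hβ0] at h1
    have h2 : β / α = D / K := by rw [hα, hβ]; field_simp
    rwa [h2] at h1
  have hfar : ∫ x in β..(1 / 2), ‖trapezoid d K x‖ ≤ 1 / 2 := by
    have h0 : (0 : ℝ) ∉ Set.uIcc β (1 / 2) := by
      rw [Set.uIcc_of_le hβh]
      exact fun h => hβ0.not_ge h.1
    have hi : IntervalIntegrable (fun x : ℝ => x ^ (-2 : ℤ)) volume β (1 / 2) :=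
      intervalIntegral.intervalIntegrable_zpow (Or.inr h0)
    have h1 : ∫ x in β..(1 / 2), ‖trapezoid d K x‖ ≤
        ∫ x in β..(1 / 2), (4 * K : ℝ)⁻¹ * x ^ (-2 : ℤ) := by
      refine intervalIntegral.integral_mono_on hβh (hint _ _) (hi.const_mul _) fun x hx => ?_
      have hx0 : 0 < x := hβ0.trans_le hx.1
      rw [norm_trapezoid, inv_mul_le_iff₀ hK0]
      calc _ ≤ (2 * x)⁻¹ * (2 * x)⁻¹ := mul_le_mul (norm_dirichlet_le_inv _ hx0 hx.2)
              (norm_dirichlet_le_inv _ hx0 hx.2) (norm_nonneg _) (by positivity)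
        _ = _ := by
          rw [zpow_neg, zpow_ofNat]
          field_simp
          norm_num
    rw [intervalIntegral.integral_const_mul, integral_zpow (Or.inr ⟨by norm_num, h0⟩)] at h1
    have h2 : ((1 / 2 : ℝ) ^ (-2 + 1 : ℤ) - β ^ (-2 + 1 : ℤ)) / (((-2 : ℤ) : ℝ) + 1) =
        2 * K - 2 := by
      rw [show (-2 + 1 : ℤ) = -1 by norm_num, zpow_neg_one, zpow_neg_one, hβ, inv_inv]
      push_cast
      ring
    rw [h2] at h1
    refine h1.trans ?_
    rw [inv_mul_le_iff₀ (by positivity)]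
    linarith
  have hsplit : ∫ x in (0 : ℝ)..(1 / 2), ‖trapezoid d K x‖ =
      (∫ x in (0 : ℝ)..α, ‖trapezoid d K x‖) + (∫ x in α..β, ‖trapezoid d K x‖) +
        ∫ x in β..(1 / 2), ‖trapezoid d K x‖ := by
    rw [intervalIntegral.integral_add_adjacent_intervals (hint _ _) (hint _ _),
      intervalIntegral.integral_add_adjacent_intervals (hint _ _) (hint _ _)]
  have hlog : (D : ℝ) / K = 1 + 2 * d / K := by
    rw [hD]; push_cast; field_simp
  rw [hlog] at hmid
  rw [hhalf, hsplit]
  linarith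

/-- The trapezoidal kernel reproduces `e(ax)`, `|a| ≤ d`, from its values at `K + 2d` equally
spaced nodes. -/
lemma sum_e_mul_trapezoid {d K : ℕ} (hK : 0 < K) {a : ℤ} (ha : |a| ≤ d) (t x : ℝ) :
    ∑ l ∈ Finset.range (K + 2 * d), e (a * (t + l / (K + 2 * d : ℕ))) *
      trapezoid d K (x - (t + l / (K + 2 * d : ℕ))) = (K + 2 * d : ℕ) * e (a * x) := by
  set D : ℕ := K + 2 * d with hD
  set c : ℤ := (K : ℤ) - 1 + d with hc
  have hK' : (K : ℂ) ≠ 0 := by exact_mod_cast hK.ne'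
  rw [abs_le] at ha
  -- For each `j`, only the term `i = a + c - j` survives the summation over the nodes.
  have hinner : ∀ j ∈ Finset.range K, ∑ i ∈ Finset.range D, ∑ l ∈ Finset.range D,
      e (((i + j - c : ℤ) : ℝ) * (x - (t + l / D)) + a * (t + l / D)) = D * e (a * x) := by
    intro j hj
    rw [Finset.mem_range] at hj
    have hterm : ∀ i l : ℕ, e (((i + j - c : ℤ) : ℝ) * (x - (t + l / D)) + a * (t + l / D)) =
        e (((i + j - c : ℤ) : ℝ) * (x - t) + a * t) *
          e (((a + c - j - i : ℤ) : ℝ) * (l / D)) := by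
      intro i l
      rw [← e_add]
      congr 1
      push_cast
      ring
    simp_rw [hterm, ← Finset.mul_sum]
    obtain ⟨q, hq⟩ : ∃ q : ℕ, a + c - j = q := Int.eq_ofNat_of_zero_le (by omega)
    have hqD : q ∈ Finset.range D := by rw [Finset.mem_range]; omega
    rw [Finset.sum_eq_single_of_mem q hqD]
    · have h1 : ∀ l ∈ Finset.range D, e (((a + c - j - q : ℤ) : ℝ) * (l / D)) = 1 := by
        intro l _
        rw [hq, sub_self, Int.cast_zero, zero_mul, e_zero]
      rw [Finset.sum_congr rfl h1, show (q + j - c : ℤ) = a by omega]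
      simp only [Finset.sum_const, Finset.card_range, nsmul_eq_mul, mul_one]
      rw [mul_comm, ← mul_add, sub_add_cancel]
    · intro i hi hiq
      rw [Finset.mem_range] at hi hqD
      rw [hq, sum_e_mul_div_eq_zero (by omega) (by rw [abs_lt]; omega), mul_zero]
  have hexp : ∀ l ∈ Finset.range D, e (a * (t + l / D)) * trapezoid d K (x - (t + l / D)) =
      (K : ℂ)⁻¹ * ∑ j ∈ Finset.range K, ∑ i ∈ Finset.range D,
        e (((i + j - c : ℤ) : ℝ) * (x - (t + l / D)) + a * (t + l / D)) := by
    intro l _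
    rw [trapezoid, dirichlet, dirichlet, Finset.sum_mul_sum, Finset.sum_comm, ← mul_assoc,
      ← mul_assoc, mul_comm _ (K : ℂ)⁻¹, mul_assoc, mul_assoc]
    congr 1
    simp_rw [Finset.mul_sum]
    refine Finset.sum_congr rfl fun j _ => Finset.sum_congr rfl fun i _ => ?_
    simp only [← e_add]
    rw [hc]
    congr 1
    push_cast
    ring
  rw [Finset.sum_congr rfl hexp, ← Finset.mul_sum, Finset.sum_comm]
  have h1 : ∀ j ∈ Finset.range K, ∑ l ∈ Finset.range D, ∑ i ∈ Finset.range D,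
      e (((i + j - c : ℤ) : ℝ) * (x - (t + l / D)) + a * (t + l / D)) = D * e (a * x) := by
    intro j hj
    rw [Finset.sum_comm]
    exact hinner j hj
  rw [Finset.sum_congr rfl h1]
  simp only [Finset.sum_const, Finset.card_range, nsmul_eq_mul]
  field_simp

/-- Marcinkiewicz–Zygmund inequality: the `L¹` norm of a trigonometric polynomial of degree at
most `d` is controlled by its values at `K + 2d` equally spaced nodes. -/
lemma integral_norm_le_sum_nodes {ι : Type*} (s : Finset ι) (b : ι → ℤ) (c : ι → ℂ) {d K : ℕ}
    (hK : 0 < K) (hb : ∀ i ∈ s, |b i| ≤ d) (t : ℝ) :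
    (K + 2 * d : ℕ) * ∫ x in (0 : ℝ)..1, ‖∑ i ∈ s, c i * e (b i * x)‖ ≤
      (2 + Real.log (1 + 2 * d / K)) * ∑ l ∈ Finset.range (K + 2 * d),
        ‖∑ i ∈ s, c i * e (b i * (t + l / (K + 2 * d : ℕ)))‖ := by
  set D : ℕ := K + 2 * d with hD
  have hpt : ∀ x : ℝ, (D : ℝ) * ‖∑ i ∈ s, c i * e (b i * x)‖ ≤
      ∑ l ∈ Finset.range D, ‖∑ i ∈ s, c i * e (b i * (t + l / D))‖ *
        ‖trapezoid d K (x - (t + l / D))‖ := by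
    intro x
    have h1 : (D : ℂ) * ∑ i ∈ s, c i * e (b i * x) =
        ∑ l ∈ Finset.range D, (∑ i ∈ s, c i * e (b i * (t + l / D))) *
          trapezoid d K (x - (t + l / D)) := by
      simp_rw [Finset.sum_mul]
      rw [Finset.sum_comm, Finset.mul_sum]
      refine Finset.sum_congr rfl fun i hi => ?_
      simp_rw [mul_assoc]
      rw [← Finset.mul_sum, sum_e_mul_trapezoid hK (hb i hi)]
      ring
    have h2 := congrArg norm h1
    rw [norm_mul, Complex.norm_natCast] at h2
    rw [h2]
    refine (norm_sum_le _ _).trans (le_of_eq ?_)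
    simp only [norm_mul]
  have hshift : ∀ y : ℝ, ∫ x in (0 : ℝ)..1, ‖trapezoid d K (x - y)‖ ≤
      2 + Real.log (1 + 2 * d / K) := by
    intro y
    have hper : Function.Periodic (fun x => ‖trapezoid d K x‖) 1 := fun x => by
      simp only [trapezoid_periodic d K x]
    have h1 := hper.intervalIntegral_add_eq (0 - y) 0
    rw [intervalIntegral.integral_comp_sub_right (fun x => ‖trapezoid d K x‖),
      show (1 : ℝ) - y = 0 - y + 1 by ring, h1, zero_add]
    exact integral_norm_trapezoid_le d hK
  rw [← intervalIntegral.integral_const_mul]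
  calc _ ≤ ∫ x in (0 : ℝ)..1, ∑ l ∈ Finset.range D, ‖∑ i ∈ s, c i * e (b i * (t + l / D))‖ *
        ‖trapezoid d K (x - (t + l / D))‖ :=
        intervalIntegral.integral_mono_on zero_le_one
          (Continuous.intervalIntegrable (by fun_prop) _ _)
          (Continuous.intervalIntegrable (by fun_prop) _ _) fun x _ => hpt x
    _ = ∑ l ∈ Finset.range D, ‖∑ i ∈ s, c i * e (b i * (t + l / D))‖ *
        ∫ x in (0 : ℝ)..1, ‖trapezoid d K (x - (t + l / D))‖ := by
        rw [intervalIntegral.integral_finsetSum fun l _ =>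
          Continuous.intervalIntegrable (by fun_prop) _ _]
        simp only [intervalIntegral.integral_const_mul]
    _ ≤ _ := by
        rw [Finset.mul_sum]
        refine Finset.sum_le_sum fun l _ => ?_
        rw [mul_comm (2 + _)]
        gcongr
        exact hshift _

/-! ### Strongly multidimensional sets -/

lemma log_card_le_sum_inv (n : ℕ) (hn : 0 < n) :
    Real.log n ≤ ∑ j : Fin n, (((j : ℕ) : ℝ) + 1)⁻¹ := by
  have h1 := log_add_one_le_harmonic n
  rw [harmonic, ← Fin.sum_univ_eq_sum_range (fun i => (((i + 1 : ℕ) : ℚ))⁻¹)] at h1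
  push_cast at h1
  refine le_trans ?_ h1
  apply Real.log_le_log
  · exact_mod_cast hn
  · linarith

/-- The translates `B k + kD` are disjoint because `D > 2d`. -/
lemma sum_biUnion_image (d D : ℕ) (hD : 2 * d < D) (I : Finset ℤ) (B : ℤ → Finset ℤ)
    (hB : ∀ k ∈ I, B k ⊆ Finset.Icc (-(d : ℤ)) d) (f : ℤ → ℂ) :
    ∑ a ∈ I.biUnion (fun k => (B k).image (fun x => x + k * (D : ℤ))), f a =
      ∑ k ∈ I, ∑ x ∈ B k, f (x + k * D) := by
  rw [Finset.sum_biUnion]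
  · exact Finset.sum_congr rfl fun k _ => Finset.sum_image fun x _ y _ h => add_right_cancel h
  · intro k hk k' hk' hne
    rw [Function.onFun, Finset.disjoint_left]
    intro a ha ha'
    obtain ⟨x, hx, rfl⟩ := Finset.mem_image.1 ha
    obtain ⟨y, hy, hxy⟩ := Finset.mem_image.1 ha'
    have h1 := Finset.mem_Icc.1 (hB k hk hx)
    have h2 := Finset.mem_Icc.1 (hB k' hk' hy)
    have h3 : (D : ℤ) ∣ y - x := ⟨k - k', by linear_combination hxy⟩
    have h4 := Int.eq_zero_of_abs_lt_dvd h3 (by rw [abs_lt]; omega)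
    have h5 : (k - k') * (D : ℤ) = 0 := by linear_combination h4 - hxy
    have h6 : (D : ℤ) ≠ 0 := by omega
    have := (mul_eq_zero.1 h5).resolve_right h6
    exact hne (by omega)

/-- The weighted `L¹` norms of the fibres are bounded by the `L¹` norm of the two-variable
polynomial `∑_k f_k(x) e(kDs)`. -/
lemma sum_fibre_integral_le {C : ℝ} (hC : IsMPSConstant C) {D : ℕ} (hD : 0 < D)
    (I : Finset ℤ) (f : ℤ → ℝ → ℂ) (hf : ∀ k, Continuous (f k)) :
    C * ∑ j : Fin I.card, (((j : ℕ) : ℝ) + 1)⁻¹ *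
        ∫ x in (0 : ℝ)..1, ‖f (I.orderEmbOfFin rfl j) x‖ ≤
      ∫ s in (0 : ℝ)..1, ∫ x in (0 : ℝ)..1, ‖∑ k ∈ I, f k x * e (((k * D : ℤ) : ℝ) * s)‖ := by
  have hcont : Continuous (Function.uncurry fun s x : ℝ =>
      ‖∑ k ∈ I, f k x * e (((k * D : ℤ) : ℝ) * s)‖) := by
    unfold Function.uncurry
    refine (continuous_finsetSum _ fun k _ => ?_).norm
    exact ((hf k).comp continuous_snd).mul (by fun_prop)
  rw [intervalIntegral_intervalIntegral_swap
    ((hcont.continuousOn.integrableOn_compact (isCompact_uIcc.prod isCompact_uIcc)).mono_set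
      (Set.prod_mono Set.uIoc_subset_uIcc Set.uIoc_subset_uIcc))]
  have hpt : ∀ x : ℝ, C * ∑ j : Fin I.card, (((j : ℕ) : ℝ) + 1)⁻¹ *
      ‖f (I.orderEmbOfFin rfl j) x‖ ≤
      ∫ s in (0 : ℝ)..1, ‖∑ k ∈ I, f k x * e (((k * D : ℤ) : ℝ) * s)‖ := by
    intro x
    have h1 := hC I.card (fun j => I.orderEmbOfFin rfl j * (D : ℤ))
      (fun j => f (I.orderEmbOfFin rfl j) x) (fun i j hij =>
        mul_lt_mul_of_pos_right ((I.orderEmbOfFin rfl).strictMono hij) (by exact_mod_cast hD))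
    have h2 : ∀ s : ℝ, ∑ j : Fin I.card, f (I.orderEmbOfFin rfl j) x *
        e (((I.orderEmbOfFin rfl j * (D : ℤ) : ℤ) : ℝ) * s) =
        ∑ k ∈ I, f k x * e (((k * D : ℤ) : ℝ) * s) := by
      intro s
      conv_rhs => rw [← Finset.map_orderEmbOfFin_univ I rfl]
      rw [Finset.sum_map]
      rfl
    simp_rw [h2] at h1
    simpa only [div_eq_inv_mul] using h1
  calc _ = ∫ x in (0 : ℝ)..1, C * ∑ j : Fin I.card, (((j : ℕ) : ℝ) + 1)⁻¹ *
        ‖f (I.orderEmbOfFin rfl j) x‖ := by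
        rw [intervalIntegral.integral_const_mul, intervalIntegral.integral_finsetSum fun j _ =>
          Continuous.intervalIntegrable (by fun_prop) _ _]
        simp only [intervalIntegral.integral_const_mul]
    _ ≤ _ := intervalIntegral.integral_mono_on zero_le_one
        (Continuous.intervalIntegrable (by fun_prop) _ _)
        (Continuous.intervalIntegrable
          (intervalIntegral.continuous_parametric_intervalIntegral_of_continuous'
            (f := fun x s => ‖∑ k ∈ I, f k x * e (((k * D : ℤ) : ℝ) * s)‖)
            (hcont.comp continuous_swap) 0 1) _ _) fun x _ => hpt x

/-- Passing to the two-variable polynomial `∑_k f_k(x) e(kDs)` costs only the `L¹` norm of the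
trapezoidal kernel. -/
lemma integral_twoVariable_le {d K : ℕ} (hK : 0 < K) (I : Finset ℤ) (B : ℤ → Finset ℤ)
    (hB : ∀ k ∈ I, B k ⊆ Finset.Icc (-(d : ℤ)) d) :
    ∫ s in (0 : ℝ)..1, ∫ x in (0 : ℝ)..1,
        ‖∑ k ∈ I, (∑ a ∈ B k, e ((a : ℝ) * x)) * e (((k * (K + 2 * d : ℕ) : ℤ) : ℝ) * s)‖ ≤
      (2 + Real.log (1 + 2 * d / K)) * ∫ t in (0 : ℝ)..1,
        ‖∑ a ∈ I.biUnion (fun k => (B k).image (fun x => x + k * ((K + 2 * d : ℕ) : ℤ))),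
          e ((a : ℝ) * t)‖ := by
  set D : ℕ := K + 2 * d with hD
  have hD0 : (D : ℝ) ≠ 0 := by
    have : 0 < D := by omega
    exact_mod_cast this.ne'
  set f : ℝ → ℂ := fun t => ∑ a ∈ I.biUnion (fun k => (B k).image (fun x => x + k * (D : ℤ))),
    e ((a : ℝ) * t) with hf
  have hfc : Continuous f := by fun_prop
  have hfp : Function.Periodic f 1 := fun t =>
    Finset.sum_congr rfl fun a _ => e_int_mul_periodic a t
  have hsig : ∀ s x : ℝ, ∑ k ∈ I, (∑ a ∈ B k, e ((a : ℝ) * x)) * e (((k * D : ℤ) : ℝ) * s) =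
      ∑ i ∈ I.sigma B, e (((i.1 * D : ℤ) : ℝ) * s) * e ((i.2 : ℝ) * x) := by
    intro s x
    rw [Finset.sum_sigma]
    refine Finset.sum_congr rfl fun k _ => ?_
    rw [mul_comm, Finset.mul_sum]
  have hnode : ∀ (s : ℝ) (l : ℕ), ∑ i ∈ I.sigma B, e (((i.1 * D : ℤ) : ℝ) * s) *
      e ((i.2 : ℝ) * (s + l / D)) = f (s + l / D) := by
    intro s l
    rw [hf]
    simp only
    rw [sum_biUnion_image d D (by omega) I B hB fun a => e ((a : ℝ) * (s + l / D)),
      Finset.sum_sigma]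
    refine Finset.sum_congr rfl fun k _ => Finset.sum_congr rfl fun a _ => ?_
    have h1 : ((a + k * D : ℤ) : ℝ) * (s + l / D) =
        ((k * D : ℤ) : ℝ) * s + (a : ℝ) * (s + l / D) + ((k * l : ℤ) : ℝ) := by
      push_cast
      field_simp
      ring
    rw [h1, e_add, e_int, mul_one, e_add]
  have hs : ∀ s : ℝ, D * ∫ x in (0 : ℝ)..1,
      ‖∑ k ∈ I, (∑ a ∈ B k, e ((a : ℝ) * x)) * e (((k * D : ℤ) : ℝ) * s)‖ ≤
      (2 + Real.log (1 + 2 * d / K)) * ∑ l ∈ Finset.range D, ‖f (s + l / D)‖ := by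
    intro s
    have h1 := integral_norm_le_sum_nodes (I.sigma B) (fun i => i.2)
      (fun i => e (((i.1 * D : ℤ) : ℝ) * s)) hK (d := d) (fun i hi => by
        obtain ⟨h1, h2⟩ := Finset.mem_sigma.1 hi
        have := Finset.mem_Icc.1 (hB _ h1 h2)
        rw [abs_le]
        exact this) s
    rw [← hD] at h1
    simp_rw [hnode] at h1
    simpa only [hsig] using h1
  have hshift : ∀ l : ℕ, ∫ s in (0 : ℝ)..1, ‖f (s + l / D)‖ = ∫ t in (0 : ℝ)..1, ‖f t‖ := by
    intro l
    have hper : Function.Periodic (fun x => ‖f x‖) 1 := fun x => by simp only [hfp x]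
    have h1 := hper.intervalIntegral_add_eq (0 + l / D) 0
    rw [intervalIntegral.integral_comp_add_right (fun x => ‖f x‖),
      show (1 : ℝ) + l / D = 0 + l / D + 1 by ring, h1, zero_add]
  have hcont : Continuous (fun s : ℝ => ∫ x in (0 : ℝ)..1,
      ‖∑ k ∈ I, (∑ a ∈ B k, e ((a : ℝ) * x)) * e (((k * D : ℤ) : ℝ) * s)‖) := by
    refine intervalIntegral.continuous_parametric_intervalIntegral_of_continuous' ?_ 0 1
    unfold Function.uncurry
    fun_prop
  have hmono := intervalIntegral.integral_mono_on (a := 0) (b := 1) (μ := volume) zero_le_one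
    (Continuous.intervalIntegrable (hcont.const_mul (D : ℝ)) _ _)
    (Continuous.intervalIntegrable (by fun_prop) _ _) fun s _ => hs s
  rw [intervalIntegral.integral_const_mul, intervalIntegral.integral_const_mul,
    intervalIntegral.integral_finsetSum fun l _ =>
      Continuous.intervalIntegrable (by fun_prop) _ _, Finset.sum_congr rfl fun l _ => hshift l,
    Finset.sum_const, Finset.card_range, nsmul_eq_mul, mul_left_comm] at hmono
  exact le_of_mul_le_mul_left hmono (by positivity)

/-- One step of the induction on the dimension. -/
lemma log_card_mul_le_integral {C : ℝ} (hC0 : 0 ≤ C) (hC : IsMPSConstant C) {d K : ℕ}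
    (hK : 0 < K) {I : Finset ℤ} (hI : I.Nonempty) {B : ℤ → Finset ℤ}
    (hB : ∀ k ∈ I, B k ⊆ Finset.Icc (-(d : ℤ)) d) {M : ℝ} (hM0 : 0 ≤ M)
    (hM : ∀ k ∈ I, M ≤ ∫ t in (0 : ℝ)..1, ‖∑ a ∈ B k, e ((a : ℝ) * t)‖) :
    C * (Real.log I.card * M) ≤
      (2 + Real.log (1 + 2 * d / K)) * ∫ t in (0 : ℝ)..1,
        ‖∑ a ∈ I.biUnion (fun k => (B k).image (fun x => x + k * ((K + 2 * d : ℕ) : ℤ))),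
          e ((a : ℝ) * t)‖ := by
  refine le_trans ?_ ((sum_fibre_integral_le hC (D := K + 2 * d) (by omega) I
    (fun k x => ∑ a ∈ B k, e ((a : ℝ) * x)) fun k => by fun_prop).trans
      (integral_twoVariable_le hK I B hB))
  refine mul_le_mul_of_nonneg_left ?_ hC0
  refine (mul_le_mul_of_nonneg_right (log_card_le_sum_inv _ hI.card_pos) hM0).trans ?_
  rw [Finset.sum_mul]
  refine Finset.sum_le_sum fun j _ => ?_
  exact mul_le_mul_of_nonneg_left (hM _ (I.orderEmbOfFin_mem rfl j)) (by positivity)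

lemma log_card_le_integral {C : ℝ} (hC0 : 0 ≤ C) (hC : IsMPSConstant C) {A : Finset ℤ}
    (hA : A.Nonempty) :
    C * Real.log A.card ≤ ∫ t in (0 : ℝ)..1, ‖∑ a ∈ A, e ((a : ℝ) * t)‖ := by
  have h := sum_fibre_integral_le hC one_pos A (fun _ _ => 1) fun _ => continuous_const
  simp only [norm_one, intervalIntegral.integral_const, sub_zero, one_smul, mul_one, one_mul,
    Nat.cast_one] at h
  exact (mul_le_mul_of_nonneg_left (log_card_le_sum_inv _ hA.card_pos) hC0).trans h

lemma IsStronglyDim.nonempty : ∀ {m : ℕ} {δ : Fin m → ℝ} {n : Fin (m + 1) → ℕ} {A : Finset ℤ},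
    (∀ i, 0 < n i) → IsStronglyDim m δ n A → A.Nonempty
  | 0, _, _, _, hn, h => Finset.card_pos.1 ((hn 0).trans_le h)
  | m + 1, _, _, _, hn, h => by
    obtain ⟨d₁, d₂, I, B, -, hI, hB, rfl⟩ := h
    obtain ⟨k, hk⟩ := Finset.card_pos.1 ((hn 0).trans_le hI)
    obtain ⟨x, hx⟩ := IsStronglyDim.nonempty (fun i => hn i.succ) (hB k hk).2
    exact ⟨_, Finset.mem_biUnion.2 ⟨k, hk, Finset.mem_image_of_mem _ hx⟩⟩

lemma two_add_log_pos {x : ℝ} (hx : 0 < x) : 0 < 2 + Real.log (1 + 2 / x) := by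
  have : 0 ≤ Real.log (1 + 2 / x) := Real.log_nonneg (by linarith [div_pos two_pos hx])
  linarith

/-- The lower bound without the loss of `2 ^ 9 π` per dimension. -/
theorem IsStronglyDim.le_integral {C : ℝ} (hC0 : 0 ≤ C) (hC : IsMPSConstant C) :
    ∀ {m : ℕ} {δ : Fin m → ℝ} {n : Fin (m + 1) → ℕ} {A : Finset ℤ}, (∀ i, 0 < δ i) →
      (∀ i, 0 < n i) → IsStronglyDim m δ n A →
      C ^ (m + 1) * (∏ j : Fin m, (2 + Real.log (1 + 2 / δ j))⁻¹) *
        ∏ i : Fin (m + 1), Real.log (n i) ≤ ∫ t in (0 : ℝ)..1, ‖∑ a ∈ A, e ((a : ℝ) * t)‖ := by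
  intro m
  induction m with
  | zero =>
    intro δ n A _ hn h
    have h1 := log_card_le_integral hC0 hC (h.nonempty hn)
    have h2 : Real.log (n 0) ≤ Real.log A.card :=
      Real.log_le_log (by exact_mod_cast hn 0) (by exact_mod_cast h)
    simpa using (mul_le_mul_of_nonneg_left h2 hC0).trans h1
  | succ m ih =>
    intro δ n A hδ hn h
    obtain ⟨d₁, d₂, I, B, hd, hI, hB, rfl⟩ := h
    have hI' : I.Nonempty := Finset.card_pos.1 ((hn 0).trans_le hI)
    -- A negative `d₁` would leave only empty fibres.
    have hd₁ : 0 ≤ d₁ := by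
      obtain ⟨k, hk⟩ := hI'
      obtain ⟨x, hx⟩ := (hB k hk).2.nonempty fun i => hn i.succ
      have := Finset.mem_Icc.1 ((hB k hk).1 hx)
      omega
    lift d₁ to ℕ using hd₁ with d
    have hδd : 0 ≤ δ 0 * d := mul_nonneg (hδ 0).le d.cast_nonneg
    rw [Int.cast_natCast] at hd
    have hd₂ : 2 * (d : ℤ) < d₂ := by
      have : (2 * d : ℝ) < d₂ := by linarith
      exact_mod_cast this
    obtain ⟨K, hK⟩ : ∃ K : ℕ, d₂ - 2 * d = K := Int.eq_ofNat_of_zero_le (by omega)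
    obtain rfl : d₂ = ((K + 2 * d : ℕ) : ℤ) := by push_cast; omega
    have hK0 : 0 < K := by push_cast at hd₂; omega
    have hKr : (0 : ℝ) < K := by exact_mod_cast hK0
    set M : ℝ := C ^ (m + 1) * (∏ j : Fin m, (2 + Real.log (1 + 2 / δ j.succ))⁻¹) *
      ∏ i : Fin (m + 1), Real.log (n i.succ) with hM
    have hM0 : 0 ≤ M := by
      refine mul_nonneg (mul_nonneg (by positivity) (Finset.prod_nonneg fun j _ => ?_))
        (Finset.prod_nonneg fun i _ => Real.log_natCast_nonneg _)
      exact inv_nonneg.2 (two_add_log_pos (hδ _)).le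
    have hstep := log_card_mul_le_integral hC0 hC hK0 hI' (fun k hk => (hB k hk).1) hM0
      fun k hk => ih (fun i => hδ i.succ) (fun i => hn i.succ) (hB k hk).2
    set J := ∫ t in (0 : ℝ)..1, ‖∑ a ∈ I.biUnion
      (fun k => (B k).image (fun x => x + k * ((K + 2 * d : ℕ) : ℤ))), e ((a : ℝ) * t)‖ with hJ
    have hJ0 : 0 ≤ J := intervalIntegral.integral_nonneg zero_le_one fun t _ => norm_nonneg _
    have hlog : Real.log (1 + 2 * d / K) ≤ Real.log (1 + 2 / δ 0) := by
      apply Real.log_le_log (by positivity)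
      have : (2 * d / K : ℝ) ≤ 2 / δ 0 := by
        rw [div_le_div_iff₀ hKr (hδ 0)]
        push_cast at hd
        linarith
      linarith
    have hcard : Real.log (n 0) ≤ Real.log I.card :=
      Real.log_le_log (by exact_mod_cast hn 0) (by exact_mod_cast hI)
    have hfin : C * (Real.log (n 0) * M) ≤ (2 + Real.log (1 + 2 / δ 0)) * J :=
      calc _ ≤ C * (Real.log I.card * M) := by gcongr
        _ ≤ _ := hstep
        _ ≤ _ := by gcongr
    rw [Fin.prod_univ_succ, Fin.prod_univ_succ (fun i => Real.log (n i))]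
    calc _ = (2 + Real.log (1 + 2 / δ 0))⁻¹ * (C * (Real.log (n 0) * M)) := by
          rw [hM]; ring
      _ ≤ J := by
          rw [inv_mul_le_iff₀ (two_add_log_pos (hδ 0))]
          exact hfin

end Littlewood

theorem theorem1p4 :
    -- admissible McGehee-Pigno-Smith constants exist ...
    (∃ C : ℝ, 0 < C ∧ Littlewood.IsMPSConstant C) ∧
    -- ... and the estimate holds with any of them as `C_MPS`; here `r = m + 1`
    ∀ C : ℝ, 0 < C → Littlewood.IsMPSConstant C →
      ∀ (m : ℕ) (δ : Fin m → ℝ) (n : Fin (m + 1) → ℕ),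
        (∀ i, 0 < δ i) → (∀ i, 0 < n i) →
        (∀ i, Real.pi ^ 3 * 2 ^ 21 * C ^ 3 * ∏ j ∈ Finset.Ici i, Real.log (n j : ℝ) ^ 3
          ≤ (n i : ℝ)) →
        ∀ A : Finset ℤ, Littlewood.IsStronglyDim m δ n A →
          C ^ (m + 1) * ((2 ^ 9 * Real.pi) ^ (m + 1))⁻¹ *
              (∏ j : Fin m, (2 + Real.log (1 + 2 / δ j))⁻¹) *
              ∏ i : Fin (m + 1), Real.log (n i : ℝ)
            ≤ ∫ t in (0 : ℝ)..1, ‖∑ a ∈ A, Littlewood.e ((a : ℝ) * t)‖ := by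
  refine ⟨⟨1 / 62, by norm_num, Littlewood.isMPSConstant_one_div_sixtyTwo⟩, ?_⟩
  intro C hC0 hC m δ n hδ hn _ A hA
  refine le_trans ?_ (hA.le_integral hC0.le hC hδ hn)
  have h1 : ((2 ^ 9 * Real.pi) ^ (m + 1))⁻¹ ≤ 1 :=
    inv_le_one_of_one_le₀ (one_le_pow₀ (by linarith [Real.pi_gt_three]))
  have h2 : 0 ≤ ∏ j : Fin m, (2 + Real.log (1 + 2 / δ j))⁻¹ :=
    Finset.prod_nonneg fun j _ => inv_nonneg.2 (Littlewood.two_add_log_pos (hδ j)).le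
  have h3 : 0 ≤ ∏ i : Fin (m + 1), Real.log (n i : ℝ) :=
    Finset.prod_nonneg fun i _ => Real.log_natCast_nonneg _
  have h4 : C ^ (m + 1) * ((2 ^ 9 * Real.pi) ^ (m + 1))⁻¹ ≤ C ^ (m + 1) :=
    mul_le_of_le_one_right (by positivity) h1
  gcongr
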